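/- For a set $\Omega$, a class $F\subseteq\mathbb R^\Omega$ and $\gamma>0$, a finite set $S=\{x_1,\dots,x_m\}\subseteq\Omega$ of $m$ distinct points is *$\gamma$-shattered* by $F$ if $$\sup_{r\in\mathbb R^m}\ \min_{y\in\{-1,1\}^m}\ \sup_{f\in F}\ \min_{1\le i\le m}\ y_i\,(f(x_i)-r_i)\ \ge\ \gamma ,$$ and $\operatorname{fat}_\gamma(F)\in\{0,1,2,\dots\}\cup\{\infty\}$ is the size of the largest $\gamma$-shattered set. For $F_1,\dots,F_k\subseteq\mathbb R^\Omega$, the $k$-fold maximum is $F_{\max}=\{x\mapsto\max_{1\le i\le k}f_i(x) : f_i\in F_i\}$. **Theorem.** There is a universal constant $c>0$ such that the following holds for all integers $k\ge 1$ and $d\ge 4$ and all $\gamma>0$. Let $F_1=\dots=F_k=\{x\mapsto w\cdot x+b : w\in\mathbb R^d,\ b\in\mathbb R\}$ be the class of all affine functions on $\Omega=\mathbb R^d$, and let $F_{\max}$ be their $k$-fold maximum. Then $$\operatorname{fat}_\gamma(F_{\max})\ \ge\ c\,\log(k)\sum_{i=1}^k\operatorname{fat}_\gamma(F_i),\qquad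 \sum_{i=1}^k\operatorname{fat}_\gamma(F_i)=k(d+1),$$ where $\log$ is the natural logarithm; in particular $\operatorname{fat}_\gamma(F_{\max})\ge c\,d\,k\log k$. -/

import Mathlib

open scoped ENNReal

/-- A finite set `S ⊆ Ω` is `γ`-shattered by a class `F` of real functions on `Ω` if
`sup_{r ∈ ℝ^S} min_{y ∈ {-1,1}^S} sup_{f ∈ F} min_{x ∈ S} y_x (f x - r_x) ≥ γ`.
The suprema and minima are taken in the extended reals, so that no boundedness is needed. -/
def FatShattered {Ω : Type*} (F : Set (Ω → ℝ)) (γ : ℝ) (S : Finset Ω) : Prop :=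
  (γ : EReal) ≤ ⨆ r : S → ℝ, ⨅ y : S → ({-1, 1} : Set ℝ), ⨆ f ∈ F, ⨅ x : S,
    (((y x : ℝ) * (f x - r x) : ℝ) : EReal)

/-- The `γ`-fat-shattering dimension of `F`: the size of the largest `γ`-shattered finite set,
possibly `∞`. -/
noncomputable def fatDim {Ω : Type*} (γ : ℝ) (F : Set (Ω → ℝ)) : ℕ∞ :=
  ⨆ (S : Finset Ω) (_ : FatShattered F γ S), (S.card : ℕ∞)

/-- The `k`-fold maximum of `F₁, …, F_k`: all functions `x ↦ max_i f_i x` with `f_i ∈ F_i`. -/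
def kFoldMax {Ω : Type*} {k : ℕ} (F : Fin k → Set (Ω → ℝ)) : Set (Ω → ℝ) :=
  {g | ∃ f : Fin k → Ω → ℝ, (∀ i, f i ∈ F i) ∧
    ∀ x, IsGreatest (Set.range fun i => f i x) (g x)}

/-- All affine functions `x ↦ w · x + b` on `ℝ^d`. -/
def affineFunctions (d : ℕ) : Set (EuclideanSpace ℝ (Fin d) → ℝ) :=
  {f | ∃ (w : EuclideanSpace ℝ (Fin d)) (b : ℝ), ∀ x, f x = inner ℝ w x + b}

/-!
The lower bound `fat_γ(F_max) ≥ c · d · k · log k` comes from a planar dyadic construction.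

Put `t = ⌊log₂ k⌋` and fix, for every level `j < t` and every dyadic cell `(a, c)` with
`a < 2 ^ (t - 1 - j)` and `c < 2 ^ j`, the lower left quarter of that cell: the rectangle of points
`(x, y)` with `x / 2 ^ j = 2 a` and `y / 2 ^ (t - 1 - j) = 2 c`. There are `t · 2 ^ (t - 1)`
rectangles. For *every* set `T` of rectangles there is a map `x ↦ y(x)` whose graph over
`{0, …, 2 ^ t - 1}` meets exactly the rectangles in `T`: the binary digits of `y` are determined
from the leading one on, the digit chosen at level `j` being the `j`-th digit of `x`, flipped if the
rectangle in the current cell is to be avoided (`digitPrefix`). The graph is a digital net, with two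
points in each cell; they lie on one of the two diagonals of the cell, and `T` prescribes which one
(`exists_graph_meeting_exactly`).

A rectangle is a point of `ℤ⁴` (its four sides, two of them negated), and the rectangles that
contain a given point are those in a closed orthant. Exponentiating the coordinates turns orthants
into half-spaces: for integers, `∑ r, 6 ^ (u r - τ r)` is at most `4` if `u ≤ τ`, and at least `6`
otherwise. All these half-spaces `∑ r, w r * z r < 5` have the same constant term, so `⌊d / 4⌋`
copies of the configuration can be placed in complementary coordinate subspaces of `ℝ^d` and
handled by the same `k` affine functions (`exists_affine_separating_orthants`). Affine functions
can be rescaled, so `γ` plays no role.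

The equality `fat_γ = d + 1` for one affine class is Radon's argument: `d + 2` points carry a
nontrivial affine relation, which rules out one of the two sign patterns given by the signs of its
coefficients, while the origin and the `d` unit vectors can be interpolated arbitrarily.
-/

/-! ### Shattering -/

section Shattering

variable {Ω : Type*} {F : Set (Ω → ℝ)} {γ : ℝ} {S : Finset Ω}

theorem FatShattered.of_witness (r : S → ℝ)
    (h : ∀ y : S → ({-1, 1} : Set ℝ), ∃ f ∈ F, ∀ x : S, γ ≤ (y x : ℝ) * (f x - r x)) :
    FatShattered F γ S := by
  refine le_iSup_of_le r (le_iInf fun y => ?_)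
  obtain ⟨f, hf, hfy⟩ := h y
  exact le_iSup₂_of_le f hf (le_iInf fun x => EReal.coe_le_coe_iff.2 (hfy x))

/-- The outer supremum need not be attained, so a witness only gives positive margins. -/
theorem FatShattered.exists_witness (hγ : 0 < γ) (h : FatShattered F γ S) :
    ∃ r : S → ℝ, ∀ y : S → ({-1, 1} : Set ℝ), ∃ f ∈ F, ∀ x : S, 0 < (y x : ℝ) * (f x - r x) := by
  have h0 := lt_of_lt_of_le (EReal.coe_lt_coe_iff.2 hγ) h
  obtain ⟨r, hr⟩ := lt_iSup_iff.1 h0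
  refine ⟨r, fun y => ?_⟩
  obtain ⟨f, hf⟩ := lt_iSup_iff.1 (lt_of_lt_of_le hr (iInf_le _ y))
  obtain ⟨hfF, hf⟩ := lt_iSup_iff.1 hf
  exact ⟨f, hfF, fun x => EReal.coe_lt_coe_iff.1 (lt_of_lt_of_le hf (iInf_le _ x))⟩

/-- An indexed form of shattering, with threshold `0`. The points are automatically distinct,
because the sign patterns separate them. -/
theorem card_le_fatDim_of_forall_signs {ι : Type*} [Fintype ι] (hγ : 0 < γ) (p : ι → Ω)
    (h : ∀ T : Set ι, ∃ f ∈ F, ∀ i, (i ∈ T → γ ≤ f (p i)) ∧ (i ∉ T → f (p i) ≤ -γ)) :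
    (Fintype.card ι : ℕ∞) ≤ fatDim γ F := by
  have hp : Function.Injective p := by
    intro i j hij
    by_contra hne
    obtain ⟨f, -, hf⟩ := h {i}
    have h1 := (hf i).1 rfl
    have h2 := (hf j).2 (fun hj => hne (Eq.symm hj))
    rw [hij] at h1
    linarith
  have hS : FatShattered F γ (Finset.univ.map ⟨p, hp⟩) := by
    refine FatShattered.of_witness 0 fun y => ?_
    have hmem : ∀ i, p i ∈ Finset.univ.map ⟨p, hp⟩ := fun i => by simp
    obtain ⟨f, hfF, hf⟩ := h {i | (y ⟨p i, hmem i⟩ : ℝ) = 1}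
    refine ⟨f, hfF, ?_⟩
    rintro ⟨x, hx⟩
    obtain ⟨i, rfl⟩ : ∃ i, p i = x := by simpa using hx
    have hy : (y ⟨p i, hx⟩ : ℝ) = -1 ∨ (y ⟨p i, hx⟩ : ℝ) = 1 := (y ⟨p i, hx⟩).2
    rcases hy with hy | hy
    · have := (hf i).2 (by simp only [Set.mem_ofPred_eq, hy]; norm_num)
      simp only [hy, Pi.zero_apply]
      linarith
    · have := (hf i).1 hy
      simp only [hy, Pi.zero_apply]
      linarith
  calc (Fintype.card ι : ℕ∞) = ((Finset.univ.map ⟨p, hp⟩).card : ℕ∞) := by simp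
    _ ≤ fatDim γ F := le_iSup₂_of_le _ hS le_rfl

theorem exists_mem_kFoldMax {k : ℕ} (hk : 1 ≤ k) (G : Fin k → Set (Ω → ℝ)) (f : Fin k → Ω → ℝ)
    (hf : ∀ i, f i ∈ G i) :
    ∃ g ∈ kFoldMax G, ∀ x, IsGreatest (Set.range fun i => f i x) (g x) := by
  have : Nonempty (Fin k) := ⟨⟨0, hk⟩⟩
  have hmax : ∀ x, ∃ m, IsGreatest (Set.range fun i => f i x) m := by
    intro x
    obtain ⟨i, hi⟩ := Finite.exists_max fun i => f i x
    exact ⟨f i x, ⟨i, rfl⟩, by rintro _ ⟨j, rfl⟩; exact hi j⟩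
  choose g hg using hmax
  exact ⟨g, ⟨f, hf, hg⟩, hg⟩

end Shattering

/-! ### The class of affine functions -/

theorem smul_mem_affineFunctions {d : ℕ} {f : EuclideanSpace ℝ (Fin d) → ℝ}
    (hf : f ∈ affineFunctions d) (a : ℝ) : (fun x => a * f x) ∈ affineFunctions d := by
  obtain ⟨w, b, h⟩ := hf
  refine ⟨a • w, a * b, fun x => ?_⟩
  simp only [h, real_inner_smul_left]
  ring

theorem sum_mul_eq_zero_of_mem_affineFunctions {d : ℕ} {S : Finset (EuclideanSpace ℝ (Fin d))}
    {μ : EuclideanSpace ℝ (Fin d) → ℝ} (h1 : ∑ x ∈ S, μ x • x = 0) (h2 : ∑ x ∈ S, μ x = 0)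
    {f : EuclideanSpace ℝ (Fin d) → ℝ} (hf : f ∈ affineFunctions d) :
    ∑ x ∈ S, μ x * f x = 0 := by
  obtain ⟨w, b, h⟩ := hf
  calc ∑ x ∈ S, μ x * f x = inner ℝ w (∑ x ∈ S, μ x • x) + (∑ x ∈ S, μ x) * b := by
        simp only [h, inner_sum, real_inner_smul_right, Finset.sum_mul, mul_add,
          Finset.sum_add_distrib]
    _ = 0 := by rw [h1, h2]; simp

theorem card_le_of_fatShattered_affineFunctions {d : ℕ} {γ : ℝ} (hγ : 0 < γ)
    {S : Finset (EuclideanSpace ℝ (Fin d))} (hS : FatShattered (affineFunctions d) γ S) :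
    S.card ≤ d + 1 := by
  by_contra! hcard
  obtain ⟨μ, h1, h2, x₀, hx₀, hμ₀⟩ :=
    Module.exists_nontrivial_relation_sum_zero_of_finrank_succ_lt_card (R := ℝ) (t := S)
      (by simpa using hcard)
  obtain ⟨r, hr⟩ := hS.exists_witness hγ
  -- Realizing the signs of `ν` makes the fixed quantity `∑ ν r` negative.
  have key : ∀ ν : EuclideanSpace ℝ (Fin d) → ℝ, ∑ x ∈ S, ν x • x = 0 → ∑ x ∈ S, ν x = 0 →
      ν x₀ ≠ 0 → ∑ x : S, ν x * r x < 0 := by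
    intro ν hν1 hν2 hν0
    obtain ⟨f, hf, hfy⟩ := hr fun x => if 0 ≤ ν x then ⟨1, by simp⟩ else ⟨-1, by simp⟩
    have hpos : ∀ x : S, 0 ≤ ν x * (f x - r x) ∧ (ν x ≠ 0 → 0 < ν x * (f x - r x)) := by
      intro x
      have hx := hfy x
      split_ifs at hx with hs
      · have hx' : 0 < f x - r x := by simpa using hx
        exact ⟨mul_nonneg hs hx'.le, fun hne => mul_pos (lt_of_le_of_ne hs (Ne.symm hne)) hx'⟩
      · have hx' : f x - r x < 0 := by simpa using hx
        have := mul_pos_of_neg_of_neg (not_le.1 hs) hx'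
        exact ⟨this.le, fun _ => this⟩
    have hsum : 0 < ∑ x : S, ν x * (f x - r x) :=
      Finset.sum_pos' (fun x _ => (hpos x).1) ⟨⟨x₀, hx₀⟩, Finset.mem_univ _, (hpos _).2 hν0⟩
    have hf0 : ∑ x : S, ν x * f x = 0 := by
      rw [Finset.sum_coe_sort S fun x => ν x * f x]
      exact sum_mul_eq_zero_of_mem_affineFunctions hν1 hν2 hf
    simp only [mul_sub, Finset.sum_sub_distrib, hf0] at hsum
    linarith
  have ha := key μ h1 h2 hμ₀
  have hb := key (fun x => -μ x) (by simp [h1]) (by simp [h2]) (by simpa using hμ₀)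
  simp only [neg_mul, Finset.sum_neg_distrib] at hb
  linarith

theorem fatDim_affineFunctions (d : ℕ) {γ : ℝ} (hγ : 0 < γ) :
    fatDim γ (affineFunctions d) = ((d + 1 : ℕ) : ℕ∞) := by
  apply le_antisymm
  · exact iSup₂_le fun S hS => Nat.cast_le.2 (card_le_of_fatShattered_affineFunctions hγ hS)
  · -- The origin (index `none`) and the unit vectors.
    let p : Option (Fin d) → EuclideanSpace ℝ (Fin d) := fun o =>
      o.elim 0 fun i => EuclideanSpace.single i 1
    have := card_le_fatDim_of_forall_signs (F := affineFunctions d) hγ p ?_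
    · simpa using this
    intro T
    classical
    let v : Option (Fin d) → ℝ := fun o => if o ∈ T then γ else -γ
    refine ⟨fun x => inner ℝ (WithLp.toLp 2 fun i => v (some i) - v none) x + v none,
      ⟨_, _, fun _ => rfl⟩, fun o => ?_⟩
    have hv : inner ℝ (WithLp.toLp 2 fun i => v (some i) - v none) (p o) + v none = v o := by
      cases o <;> simp [p, EuclideanSpace.inner_single_right]
    simp only [hv, v]
    exact ⟨fun h => by simp [h], fun h => by simp [h]⟩

/-! ### Orthants as half-spaces -/

/-- Integer points in coordinate blocks `s : β` of size `4`, sent to `ℝ^d` by exponentiating their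
coordinates, such that an affine function separates the points lying below prescribed thresholds
`τ s` in their block from all others, simultaneously in all blocks. -/
theorem exists_affine_separating_orthants {d : ℕ} {β ι : Type*} (e : β × Fin 4 → Fin d)
    (he : Function.Injective e) (u : ι → Fin 4 → ℤ) :
    ∃ p : β × ι → EuclideanSpace ℝ (Fin d), ∀ τ : β → Fin 4 → ℤ, ∃ f ∈ affineFunctions d,
      ∀ s i, ((∀ r, u i r ≤ τ s r) → 1 ≤ f (p (s, i))) ∧
        ((∃ r, τ s r < u i r) → f (p (s, i)) ≤ -1) := by
  refine ⟨fun q => ∑ r, EuclideanSpace.single (e (q.1, r)) ((6 : ℝ) ^ u q.2 r), fun τ => ?_⟩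
  let w : EuclideanSpace ℝ (Fin d) :=
    WithLp.toLp 2 (Function.extend e (fun q => -(6 : ℝ) ^ (-τ q.1 q.2)) 0)
  refine ⟨fun x => inner ℝ w x + 5, ⟨w, 5, fun _ => rfl⟩, fun s i => ?_⟩
  have hval : inner ℝ w (∑ r, EuclideanSpace.single (e (s, r)) ((6 : ℝ) ^ u i r)) =
      -∑ r, (6 : ℝ) ^ (u i r - τ s r) := by
    rw [inner_sum, ← Finset.sum_neg_distrib]
    refine Finset.sum_congr rfl fun r _ => ?_
    rw [EuclideanSpace.inner_single_right]
    simp only [w, he.extend_apply, conj_trivial]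
    rw [sub_eq_add_neg, zpow_add₀ (by norm_num)]
    ring
  simp only [hval]
  constructor
  · intro h
    have : ∑ r, (6 : ℝ) ^ (u i r - τ s r) ≤ ∑ _r : Fin 4, (1 : ℝ) :=
      Finset.sum_le_sum fun r _ =>
        zpow_le_one_of_nonpos₀ (by norm_num) (sub_nonpos.2 (h r))
    norm_num at this
    linarith
  · rintro ⟨r, hr⟩
    have h1 : (6 : ℝ) ^ (1 : ℤ) ≤ (6 : ℝ) ^ (u i r - τ s r) :=
      zpow_le_zpow_right₀ (by norm_num) (by omega)
    have h2 : (6 : ℝ) ^ (u i r - τ s r) ≤ ∑ r, (6 : ℝ) ^ (u i r - τ s r) :=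
      Finset.single_le_sum (f := fun r => (6 : ℝ) ^ (u i r - τ s r))
        (fun r _ => by positivity) (Finset.mem_univ r)
    norm_num at h1
    linarith

/-! ### Graphs meeting prescribed dyadic rectangles -/

/-- The number formed by the `j` leading binary digits of `y(x)`. The digit appended at level `j`
is the `j`-th binary digit of `x`, flipped unless `T j (x / 2 ^ (j + 1)) (digitPrefix T x j)`. -/
def digitPrefix (T : ℕ → ℕ → ℕ → Bool) (x : ℕ) : ℕ → ℕ
  | 0 => 0
  | j + 1 => 2 * digitPrefix T x j +
      (x / 2 ^ j + if T j (x / 2 ^ (j + 1)) (digitPrefix T x j) then 0 else 1) % 2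

theorem digitPrefix_succ_div_two (T : ℕ → ℕ → ℕ → Bool) (x j : ℕ) :
    digitPrefix T x (j + 1) / 2 = digitPrefix T x j := by
  rw [digitPrefix]
  omega

theorem digitPrefix_add_div (T : ℕ → ℕ → ℕ → Bool) (x j n : ℕ) :
    digitPrefix T x (j + n) / 2 ^ n = digitPrefix T x j := by
  induction n with
  | zero => simp
  | succ n ih => rw [pow_succ', ← Nat.div_div_eq_div_mul, ← add_assoc, digitPrefix_succ_div_two, ih]

/-- Every cell at level `j` meets the graph: the digits of `x` below the `j`-th can be chosen to
produce any prescribed leading digits of `y(x)`. -/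
theorem exists_digitPrefix_eq (T : ℕ → ℕ → ℕ → Bool) (j : ℕ) :
    ∀ a c, c < 2 ^ j → ∃ x, x / 2 ^ j = a ∧ digitPrefix T x j = c := by
  induction j with
  | zero =>
    intro a c hc
    exact ⟨a, by simp, by simp at hc; simp [digitPrefix, hc]⟩
  | succ j ih =>
    intro a c hc
    obtain ⟨x, hx, hxc⟩ := ih (2 * a + (c + if T j a (c / 2) then 0 else 1) % 2) (c / 2)
      (by rw [pow_succ] at hc; omega)
    have hxa : x / 2 ^ (j + 1) = a := by
      rw [pow_succ, ← Nat.div_div_eq_div_mul, hx]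
      omega
    refine ⟨x, hxa, ?_⟩
    rw [digitPrefix, hxa, hxc, hx]
    split_ifs <;> omega

/-- For every set `T` of dyadic rectangles there is a function whose graph over `ℕ` avoids the
rectangles outside `T`, and whose graph over `{0, …, 2 ^ t - 1}` meets those in `T`. -/
theorem exists_graph_meeting_exactly (t : ℕ) (T : ℕ → ℕ → ℕ → Bool) :
    ∃ y : ℕ → ℕ, ∀ j a c, j < t → a < 2 ^ (t - 1 - j) → c < 2 ^ j →
      (T j a c = true →
        ∃ x < 2 ^ t, x / 2 ^ j = 2 * a ∧ y x / 2 ^ (t - 1 - j) = 2 * c) ∧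
      (T j a c = false → ∀ x, ¬(x / 2 ^ j = 2 * a ∧ y x / 2 ^ (t - 1 - j) = 2 * c)) := by
  refine ⟨fun x => digitPrefix T x t, fun j a c hj ha hc => ?_⟩
  have hy : ∀ x, digitPrefix T x t / 2 ^ (t - 1 - j) = digitPrefix T x (j + 1) := by
    intro x
    have := digitPrefix_add_div T x (j + 1) (t - 1 - j)
    rwa [show j + 1 + (t - 1 - j) = t by omega] at this
  have hxa : ∀ x, x / 2 ^ j = 2 * a → x / 2 ^ (j + 1) = a := by
    intro x hx
    rw [pow_succ, ← Nat.div_div_eq_div_mul, hx]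
    omega
  simp only [hy]
  constructor
  · intro hT
    obtain ⟨x, hx, hxc⟩ := exists_digitPrefix_eq T j (2 * a) c hc
    refine ⟨x, ?_, hx, ?_⟩
    · have ht : 2 ^ t = 2 ^ (t - 1 - j) * 2 * 2 ^ j := by
        rw [← pow_succ, ← pow_add]
        congr 1
        omega
      rw [ht, ← Nat.div_lt_iff_lt_mul (by positivity)]
      omega
    · rw [digitPrefix, hxa x hx, hxc, hx, hT]
      simp
  · rintro hT x ⟨hx, hxc⟩
    have hc' : digitPrefix T x j = c := by
      rw [← digitPrefix_succ_div_two, hxc]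
      omega
    rw [digitPrefix, hxa x hx, hc', hx, hT] at hxc
    simp at hxc

/-- The index type of the dyadic rectangles: a level `j` and a cell `(a, c)` at that level. -/
abbrev DyadicRect (t : ℕ) : Type :=
  Σ j : Fin t, Fin (2 ^ (t - 1 - j : ℕ)) × Fin (2 ^ (j : ℕ))

theorem card_dyadicRect (t : ℕ) : Fintype.card (DyadicRect t) = t * 2 ^ (t - 1) := by
  have h : ∀ j : Fin t, 2 ^ (t - 1 - j : ℕ) * 2 ^ (j : ℕ) = 2 ^ (t - 1) := fun j => by
    rw [← pow_add]
    congr 1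
    omega
  simp [Fintype.card_sigma, h]

/-- The four sides of a dyadic rectangle, upper bounds negated, so that `(x, y)` lies in the
rectangle if and only if `sides R ≤ (x, -x, y, -y)` coordinatewise. -/
def DyadicRect.sides {t : ℕ} (R : DyadicRect t) : Fin 4 → ℤ :=
  ![2 * R.2.1 * 2 ^ (R.1 : ℕ), -((2 * R.2.1 + 1) * 2 ^ (R.1 : ℕ) - 1),
    2 * R.2.2 * 2 ^ (t - 1 - R.1 : ℕ), -((2 * R.2.2 + 1) * 2 ^ (t - 1 - R.1 : ℕ) - 1)]

theorem Nat.div_eq_iff_int_bounds (x a n : ℕ) :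
    x / 2 ^ n = a ↔ (a * 2 ^ n : ℤ) ≤ x ∧ -((a + 1) * 2 ^ n - 1 : ℤ) ≤ -x := by
  have h : x / 2 ^ n = a ↔ a * 2 ^ n ≤ x ∧ x < (a + 1) * 2 ^ n := by
    rw [← Nat.le_div_iff_mul_le (by positivity), ← Nat.div_lt_iff_lt_mul (by positivity)]
    omega
  rw [h]
  zify
  constructor <;> rintro ⟨h1, h2⟩ <;> constructor <;> linarith

theorem DyadicRect.sides_le_iff {t : ℕ} (R : DyadicRect t) (x y : ℕ) :
    (∀ r, R.sides r ≤ (![x, -x, y, -y] : Fin 4 → ℤ) r) ↔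
      x / 2 ^ (R.1 : ℕ) = 2 * R.2.1 ∧ y / 2 ^ (t - 1 - R.1 : ℕ) = 2 * R.2.2 := by
  rw [Nat.div_eq_iff_int_bounds, Nat.div_eq_iff_int_bounds]
  simp [Fin.forall_fin_succ, DyadicRect.sides, and_assoc]

/-! ### The lower bound for the maximum -/

theorem card_mul_le_fatDim_kFoldMax {k d t : ℕ} (hk : 2 ^ t ≤ k) {γ : ℝ} (hγ : 0 < γ) :
    ((d / 4 * (t * 2 ^ (t - 1)) : ℕ) : ℕ∞) ≤
      fatDim γ (kFoldMax fun _ : Fin k => affineFunctions d) := by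
  have hk1 : 1 ≤ k := Nat.one_le_two_pow.trans hk
  let e : Fin (d / 4) × Fin 4 → Fin d := fun q => Fin.castLE (by omega) (finProdFinEquiv q)
  have he : Function.Injective e :=
    (Fin.castLE_injective _).comp finProdFinEquiv.injective
  obtain ⟨p, hp⟩ := exists_affine_separating_orthants e he (DyadicRect.sides (t := t))
  have hcard : Fintype.card (Fin (d / 4) × DyadicRect t) = d / 4 * (t * 2 ^ (t - 1)) := by
    rw [Fintype.card_prod, card_dyadicRect, Fintype.card_fin]
  rw [← hcard]
  refine card_le_fatDim_of_forall_signs hγ p fun T => ?_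
  classical
  have hy := fun s : Fin (d / 4) => exists_graph_meeting_exactly t fun j a c =>
    decide (∃ R : DyadicRect t, (s, R) ∈ T ∧ (R.1 : ℕ) = j ∧ (R.2.1 : ℕ) = a ∧ (R.2.2 : ℕ) = c)
  choose y hy using hy
  -- The `x`-th affine function tests the point `(x, y s x)` in every block `s`.
  choose f hfA hf using fun x : Fin k =>
    hp fun s => ![(x : ℕ), -((x : ℕ) : ℤ), (y s x : ℕ), -((y s x : ℕ) : ℤ)]
  obtain ⟨g, hg, hgf⟩ := exists_mem_kFoldMax hk1 (fun _ => affineFunctions d)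
    (fun x z => γ * f x z) fun x => smul_mem_affineFunctions (hfA x) γ
  refine ⟨g, hg, ?_⟩
  rintro ⟨s, R⟩
  have hR := hy s R.1 R.2.1 R.2.2 R.1.2 R.2.1.2 R.2.2.2
  have hT : (∃ R' : DyadicRect t, (s, R') ∈ T ∧ (R'.1 : ℕ) = R.1 ∧ (R'.2.1 : ℕ) = R.2.1 ∧
      (R'.2.2 : ℕ) = R.2.2) ↔ (s, R) ∈ T := by
    refine ⟨?_, fun h => ⟨R, h, rfl, rfl, rfl⟩⟩
    rintro ⟨⟨j, a, c⟩, hmem, h1, h2, h3⟩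
    obtain ⟨j', a', c'⟩ := R
    obtain rfl : j = j' := Fin.ext h1
    obtain rfl : a = a' := Fin.ext h2
    obtain rfl : c = c' := Fin.ext h3
    exact hmem
  simp only [decide_eq_true_eq, decide_eq_false_iff_not, hT] at hR
  constructor
  · intro hmem
    obtain ⟨x, hx, hxR⟩ := hR.1 hmem
    have h1 := (hf ⟨x, hx.trans_le hk⟩ s R).1 ((R.sides_le_iff _ _).2 hxR)
    calc γ ≤ γ * f ⟨x, hx.trans_le hk⟩ (p (s, R)) := le_mul_of_one_le_right hγ.le h1
      _ ≤ g (p (s, R)) := (hgf _).2 ⟨_, rfl⟩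
  · intro hmem
    obtain ⟨x, hx⟩ := (hgf (p (s, R))).1
    have hout := mt (R.sides_le_iff _ _).1 (hR.2 hmem x)
    have h1 := (hf x s R).2 (by simpa using hout)
    rw [← hx]
    show γ * f x (p (s, R)) ≤ -γ
    nlinarith

/-- The size of the construction for `t = ⌊log₂ k⌋`: here `8 ⌊d / 4⌋ ≥ d + 1`,
`2 ^ (t - 1) ≥ k / 4` and `2 t ≥ t + 1 ≥ log k`. -/
theorem log_mul_le_card {k d : ℕ} (hk : 2 ≤ k) (hd : 4 ≤ d) :
    1 / 64 * Real.log k * (k * (d + 1)) ≤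
      ((d / 4 * (Nat.log 2 k * 2 ^ (Nat.log 2 k - 1)) : ℕ) : ℝ) := by
  obtain ⟨n, hn⟩ : ∃ n, Nat.log 2 k = n + 1 :=
    ⟨Nat.log 2 k - 1, by have := Nat.log_pos one_lt_two hk; omega⟩
  have hlt : k < 2 ^ (n + 2) := by
    have := Nat.lt_pow_succ_log_self one_lt_two k
    rwa [hn] at this
  rw [hn, Nat.add_sub_cancel]
  have hd8 : (d + 1 : ℝ) ≤ 8 * (d / 4 : ℕ) := by
    have : d + 1 ≤ 8 * (d / 4) := by omega
    exact_mod_cast this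
  have hk4 : (k : ℝ) ≤ 4 * 2 ^ n := by
    have : k ≤ 4 * 2 ^ n := by rw [pow_add] at hlt; omega
    exact_mod_cast this
  have hkpos : (0 : ℝ) < k := by exact_mod_cast (by omega : 0 < k)
  have hlog : Real.log k ≤ 2 * (n + 1 : ℝ) := by
    calc Real.log k ≤ Real.log (2 ^ (n + 2)) :=
          Real.log_le_log hkpos (by exact_mod_cast hlt.le)
      _ = (n + 2) * Real.log 2 := by rw [Real.log_pow]; push_cast; ring
      _ ≤ (n + 2) * 1 := by
          gcongr
          linarith [Real.log_two_lt_d9]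
      _ ≤ 2 * (n + 1 : ℝ) := by linarith [(Nat.cast_nonneg n : (0 : ℝ) ≤ n)]
  calc 1 / 64 * Real.log k * (k * (d + 1))
      ≤ 1 / 64 * (2 * (n + 1 : ℝ)) * (4 * 2 ^ n * (8 * (d / 4 : ℕ))) := by gcongr
    _ = ((d / 4 * ((n + 1) * 2 ^ n) : ℕ) : ℝ) := by push_cast; ring

theorem mainTheorem5 :
    ∃ c : ℝ, 0 < c ∧ ∀ (k d : ℕ), 1 ≤ k → 4 ≤ d →
      ∀ F : Fin k → Set (EuclideanSpace ℝ (Fin d) → ℝ), (∀ i, F i = affineFunctions d) →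
        ∀ γ : ℝ, 0 < γ →
          ENNReal.ofReal (c * Real.log k) * ((∑ i, fatDim γ (F i) : ℕ∞) : ℝ≥0∞)
              ≤ (fatDim γ (kFoldMax F) : ℝ≥0∞) ∧
          (∑ i, fatDim γ (F i)) = ((k * (d + 1) : ℕ) : ℕ∞) ∧
          ENNReal.ofReal (c * d * k * Real.log k) ≤ (fatDim γ (kFoldMax F) : ℝ≥0∞) := by

  refine ⟨1 / 64, by norm_num, fun k d hk hd F hF γ hγ => ?_⟩
  obtain rfl : F = fun _ => affineFunctions d := funext hF
  have hsum : ∑ _i : Fin k, fatDim γ (affineFunctions d) = ((k * (d + 1) : ℕ) : ℕ∞) := by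
    simp [fatDim_affineFunctions d hγ, mul_add]
  have hlog : 0 ≤ Real.log k := Real.log_natCast_nonneg k
  have main : ENNReal.ofReal (1 / 64 * Real.log k * (k * (d + 1))) ≤
      (fatDim γ (kFoldMax fun _ : Fin k => affineFunctions d) : ℝ≥0∞) := by
    obtain rfl | hk2 : k = 1 ∨ 2 ≤ k := by omega
    · simp
    · calc ENNReal.ofReal (1 / 64 * Real.log k * (k * (d + 1)))
          ≤ ENNReal.ofReal ((d / 4 * (Nat.log 2 k * 2 ^ (Nat.log 2 k - 1)) : ℕ) : ℝ) :=
            ENNReal.ofReal_le_ofReal (log_mul_le_card hk2 hd)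
        _ = (((d / 4 * (Nat.log 2 k * 2 ^ (Nat.log 2 k - 1)) : ℕ) : ℕ∞) : ℝ≥0∞) := by
            rw [ENNReal.ofReal_natCast, ENat.toENNReal_coe]
        _ ≤ _ := ENat.toENNReal_le.2
            (card_mul_le_fatDim_kFoldMax (Nat.pow_log_le_self 2 (by omega)) hγ)
  refine ⟨?_, hsum, ?_⟩
  · calc ENNReal.ofReal (1 / 64 * Real.log k) *
          ((∑ _i : Fin k, fatDim γ (affineFunctions d) : ℕ∞) : ℝ≥0∞)
        = ENNReal.ofReal (1 / 64 * Real.log k * (k * (d + 1))) := by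
          rw [hsum, ENat.toENNReal_coe, ← ENNReal.ofReal_natCast,
            ← ENNReal.ofReal_mul (by positivity)]
          push_cast
          rfl
      _ ≤ _ := main
  · refine le_trans (ENNReal.ofReal_le_ofReal ?_) main
    have : 0 ≤ Real.log k * k := by positivity
    linarith
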